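/- Let $n,m\in\mathbb N$, let $f_0\colon\mathbb R^n\to\mathbb R$ and $F\colon\mathbb R^n\to\mathbb R^m$ be twice continuously differentiable, and let $g\colon\mathbb R^m\to[-\infty,\infty]$ be proper, lower semicontinuous and convex. Put $f(x,u):=f_0(x)+g(F(x)+u)$ and $L(x,y):=f_0(x)+y^\top F(x)$. For a set $C$ in a Euclidean space let $T_C(z):=\{d\mid\exists\, d_k\to d,\ t_k\downarrow 0:\ z+t_kd_k\in C\ \forall k\}$; for $z\in C$ let $\widehat N_C(z):=\{\eta\mid \eta^\top(z'-z)\le o(\|z'-z\|)\text{ for } z'\in C\}$ and $N_C(z):=\{\eta\mid\exists\, z_k\to z,\ \eta_k\to\eta:\ z_k\in C,\ \eta_k\in\widehat N_C(z_k)\ \forall k\}$. For a function $h$ with values in $[-\infty,\infty]$ and a point $z$ at which $h$ is finite, let $\partial h(z):=\{\zeta\mid(\zeta,-1)\in N_{\operatorname{epi}h}(z,h(z))\}$ and $\partial^\infty h(z):=\{\zeta\mid(\zeta,0)\in N_{\operatorname{epi}h}(z,h(z))\}$; both sets are empty at other points. Define the set-valued mappings \[ M(v,u):=\{x\mid v\in\partial_xf(x,u)\},\qquad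 Y(v,u,x):=\{y\mid (v,y)\in\partial f(x,u)\}\qquad(v,x\in\mathbb R^n,\ u\in\mathbb R^m), \] where $\partial_xf(x,u)$ is the subdifferential of $f(\cdot,u)$ at $x$. Let $\bar x\in\mathbb R^n$ be stationary for the problem of minimizing $f_0(x)+g(F(x))$ over $x\in\mathbb R^n$, that is, $\bar x\in M(0,0)$. A set-valued mapping $\Upsilon$ is \emph{isolatedly calm} at a point $(\bar p,\bar q)$ of its graph if there are $\kappa>0$ and a neighborhood $V$ of $\bar q$ with $\|q-\bar q\|\le\kappa\|p-\bar p\|$ for all $p$ and all $q\in\Upsilon(p)\cap V$. With $\operatorname{dom}\Upsilon:=\{p\mid\Upsilon(p)\ne\emptyset\}$, it is \emph{inner calm* in the fuzzy sense} with respect to $\operatorname{dom}\Upsilon$ at $\bar p$ in direction $d$ if either $d\notin T_{\operatorname{dom}\Upsilon}(\bar p)$, or there are $\kappa>0$, a point $\bar q$, and sequences $d_k\to d$, $t_k\downarrow0$, $q_k\to\bar q$ with $\bar p+t_kd_k\in\operatorname{dom}\Upsilon$, $q_k\in\Upsilon(\bar p+t_kd_k)$ and $\|q_k-\bar q\|\le\kappa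 t_k\|d_k\|$ for all $k$. A multiplier $\bar y\in Y(0,0,\bar x)$ is \emph{noncritical} for $\bar x$ if, for all $d^x\in\mathbb R^n$ and $d^y\in\mathbb R^m$, \[ \nabla^2_{xx}L(\bar x,\bar y)d^x+F'(\bar x)^\top d^y=0,\quad (F'(\bar x)d^x,d^y)\in T_{\operatorname{gph}\partial g}(F(\bar x),\bar y)\quad\Longrightarrow\quad d^x=0 . \] Consider the following statements. (i) $M$ is isolatedly calm at $((0,0),\bar x)$. (ii) Each multiplier $\bar y\in Y(0,0,\bar x)$ is noncritical for $\bar x$, and $Y$ is inner calm* in the fuzzy sense with respect to $\operatorname{dom}Y$ at $(0,0,\bar x)$ in each direction $(0,0,d^x)$ with $d^x\ne0$. Then (i) always implies (ii). Conversely, (ii) implies (i) if the qualification condition \[ F'(\bar x)^\top y=0,\quad y\in\partial^\infty g(F(\bar x))\quad\Longrightarrow\quad y=0 \] holds. -/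

import Mathlib

open Filter Topology

noncomputable section

namespace VarAnalysis

section General

variable {E F : Type*} [NormedAddCommGroup E] [InnerProductSpace ℝ E]
  [NormedAddCommGroup F] [InnerProductSpace ℝ F]

/-- The product of two Euclidean spaces, with its Euclidean norm and inner product. -/
abbrev EProd (E F : Type*) : Type _ := WithLp 2 (E × F)

/-- The pair `(a, b)` as a point of the Euclidean product space. -/
abbrev pair {E F : Type*} (a : E) (b : F) : EProd E F := WithLp.toLp 2 (a, b)

/-- Convergence `t_k ↓ 0` of a sequence of positive reals. -/
def TendsToZeroPos (t : ℕ → ℝ) : Prop := (∀ k, 0 < t k) ∧ Tendsto t atTop (𝓝 0)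

/-- The (Bouligand) tangent cone `T_C(x)`. -/
def tangentCone (C : Set E) (x : E) : Set E :=
  {d | ∃ (dk : ℕ → E) (t : ℕ → ℝ), Tendsto dk atTop (𝓝 d) ∧ TendsToZeroPos t ∧
    ∀ k, x + t k • dk k ∈ C}

/-- The regular normal cone: all `η` with `⟪η, x' - x⟫ ≤ o(‖x' - x‖)` for `x' ∈ C`. -/
def regularNormalCone (C : Set E) (x : E) : Set E :=
  {η | ∀ ε > 0, ∀ᶠ x' in 𝓝[C] x, inner ℝ η (x' - x) ≤ ε * ‖x' - x‖}

/-- The limiting normal cone `N_C(x)`. -/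
def limitingNormalCone (C : Set E) (x : E) : Set E :=
  {η | ∃ xk ηk : ℕ → E, Tendsto xk atTop (𝓝 x) ∧ Tendsto ηk atTop (𝓝 η) ∧
    ∀ k, xk k ∈ C ∧ ηk k ∈ regularNormalCone C (xk k)}

/-- The epigraph of an extended-real-valued function, a subset of `E × ℝ`. -/
def epigraph (h : E → EReal) : Set (EProd E ℝ) := {p | h p.fst ≤ (p.snd : EReal)}

/-- The limiting subdifferential of `h` at `x`; it is empty where `h` is not finite. -/
def limitingSubdiff (h : E → EReal) (x : E) : Set E :=
  {z | ∃ α : ℝ, h x = (α : EReal) ∧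
    pair z (-1 : ℝ) ∈ limitingNormalCone (epigraph h) (pair x α)}

/-- The singular subdifferential of `h` at `x`; it is empty where `h` is not finite. -/
def singularSubdiff (h : E → EReal) (x : E) : Set E :=
  {z | ∃ α : ℝ, h x = (α : EReal) ∧
    pair z (0 : ℝ) ∈ limitingNormalCone (epigraph h) (pair x α)}

/-- A function with values in `[-∞, ∞]` is proper if it is somewhere less than `∞` and nowhere
equal to `-∞`. -/
def IsProper (h : E → EReal) : Prop := (∃ x, h x < ⊤) ∧ ∀ x, ⊥ < h x

/-- Convexity of an extended-real-valued function, through its epigraph. -/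
def IsConvexFun (h : E → EReal) : Prop := Convex ℝ (epigraph h)

/-- The graph of a set-valued mapping. -/
def graphOf (Υ : E → Set F) : Set (EProd E F) := {p | p.snd ∈ Υ p.fst}

/-- The domain of a set-valued mapping. -/
def domOf (Υ : E → Set F) : Set E := {x | (Υ x).Nonempty}

/-- The graphical derivative `DΥ(x, y)`: its graph is the tangent cone to the graph of `Υ`. -/
def graphicalDeriv (Υ : E → Set F) (x : E) (y : F) : E → Set F :=
  fun dx => {dy | pair dx dy ∈ tangentCone (graphOf Υ) (pair x y)}

/-- Isolated calmness of `Υ` at the point `(x, y)` of its graph. -/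
def IsolatedlyCalmAt (Υ : E → Set F) (x : E) (y : F) : Prop :=
  ∃ κ > 0, ∃ V ∈ 𝓝 y, ∀ x', ∀ y' ∈ Υ x' ∩ V, ‖y' - y‖ ≤ κ * ‖x' - x‖

/-- Inner calmness* in the fuzzy sense of `Υ` with respect to its domain, at `x` in
direction `d`. -/
def InnerCalmStarFuzzyAt (Υ : E → Set F) (x d : E) : Prop :=
  d ∉ tangentCone (domOf Υ) x ∨
  ∃ κ > 0, ∃ (y : F) (dk : ℕ → E) (t : ℕ → ℝ) (yk : ℕ → F),
    Tendsto dk atTop (𝓝 d) ∧ TendsToZeroPos t ∧ Tendsto yk atTop (𝓝 y) ∧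
    ∀ k, x + t k • dk k ∈ domOf Υ ∧ yk k ∈ Υ (x + t k • dk k) ∧
      ‖yk k - y‖ ≤ κ * t k * ‖dk k‖

/-- The solution mapping `M(v, u) = {x | v ∈ ∂ₓ f(x, u)}`, with the subdifferential of the
function `f(·, u)`. -/
def solMap (f : EProd E F → EReal) : EProd E F → Set E :=
  fun p => {x | p.fst ∈ limitingSubdiff (fun x' => f (pair x' p.snd)) x}

/-- The multiplier mapping `Y(v, u, x) = {y | (v, y) ∈ ∂f(x, u)}`. -/
def multMap (f : EProd E F → EReal) : EProd E (EProd F E) → Set F :=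
  fun p => {y | pair p.fst y ∈ limitingSubdiff f (pair p.snd.snd p.snd.fst)}

/-- The composite function `f(x, u) = f₀(x) + g(F(x) + u)`. -/
def compositeFun (f₀ : E → ℝ) (Φ : E → F) (g : F → EReal) : EProd E F → EReal :=
  fun p => (f₀ p.fst : EReal) + g (Φ p.fst + p.snd)

/-- The Lagrangian function `L(x, y) = f₀(x) + ⟪y, F(x)⟫`. -/
def lagrangian (f₀ : E → ℝ) (Φ : E → F) (x : E) (y : F) : ℝ := f₀ x + inner ℝ y (Φ x)

/-- The Hessian `∇²ₓₓ L(x, y)`, the derivative of the gradient of `L(·, y)` at `x`. -/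
def lagrangianHess [CompleteSpace E] (f₀ : E → ℝ) (Φ : E → F) (x : E) (y : F) : E →L[ℝ] E :=
  fderiv ℝ (gradient fun x' => lagrangian f₀ Φ x' y) x

/-- The basic qualification condition:
`F'(x)ᵀ y = 0` and `y ∈ ∂^∞ g(F(x))` imply `y = 0`. -/
def BasicCQ [CompleteSpace E] [CompleteSpace F] (Φ : E → F) (g : F → EReal) (x : E) : Prop :=
  ∀ y, (fderiv ℝ Φ x).adjoint y = 0 → y ∈ singularSubdiff g (Φ x) → y = 0

/-- Noncriticality of the multiplier `y` for `x`. -/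
def IsNoncritical [CompleteSpace E] [CompleteSpace F]
    (f₀ : E → ℝ) (Φ : E → F) (g : F → EReal) (x : E) (y : F) : Prop :=
  ∀ (dx : E) (dy : F),
    lagrangianHess f₀ Φ x y dx + (fderiv ℝ Φ x).adjoint dy = 0 →
    dy ∈ graphicalDeriv (limitingSubdiff g) (Φ x) y (fderiv ℝ Φ x dx) →
    dx = 0

end General

end VarAnalysis

end

/-!
The subdifferential mapping `∂g` of a proper lower semicontinuous convex `g` has a closed graph, and
since `(x, u) ↦ F(x) + u` is a submersion, `y ∈ Y(v, u, x)` holds exactly when `v = ∇ₓL(x, y)` and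
`y ∈ ∂g(F(x) + u)` (`mem_multMap_iff`). In particular the domain of `Y` is contained in
`{(v, u, x) | x ∈ M(v, u)}`, and under the qualification condition the two sets agree near the
reference point (`exists_mem_multMap_of_mem_solMap`, `BasicCQ.eventually`). Everything else is a
comparison of difference quotients.

Isolated calmness of `M` says that no sequence `xₖ = x̄ + tₖ dₖ` with `tₖ ↓ 0`, `dₖ → d ≠ 0` solves
the problem at parameters `(vₖ, uₖ) = o(tₖ)` (`IsolatedlyCalmAt.eq_zero_of_tendsto`). A critical
direction `(dx, dy)` of a multiplier `ȳ` would give such a sequence: with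
`F(x̄) + tₖ aₖ` and `ȳ + tₖ bₖ` realizing the tangent to `gph ∂g`, take `xₖ = x̄ + tₖ dx`,
`uₖ = F(x̄) + tₖ aₖ - F(xₖ)` and `vₖ = ∇ₓL(xₖ, ȳ + tₖ bₖ)`. So would a tangent `(0, 0, dx)` to the
domain of `Y`; hence inner calmness* holds because these directions are not tangent.

Conversely, a failure of isolated calmness gives, through the qualification condition, a tangent
`(0, 0, dx)` to the domain of `Y` with `dx ≠ 0` (`exists_mem_tangentCone_domOf_multMap`). Inner
calmness* then supplies multipliers `yₖ → ȳ` with `(yₖ - ȳ) / tₖ` bounded, and a cluster point `dy`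
of these quotients makes `(dx, dy)` a critical direction of `ȳ` (`eq_zero_of_multipliers`).

The analytic core is the chain rule `exists_mem_limitingSubdiff_of_mem_add_comp` for limiting
subdifferentials. It follows from the formula for normals to `G⁻¹(D)`, with `D` closed and convex
(`exists_pullback_of_mem_limitingNormalCone`), since the epigraph of `φ + g ∘ Ψ` is such a preimage
of the epigraph of `g`. That formula is proved by penalization
(`exists_approx_pullback_of_mem_regularNormalCone`), which needs neither metric regularity nor a
variational principle beyond compactness.
-/

open Filter Topology

noncomputable section

namespace VarAnalysis

/-! ### Normals to convex sets -/

section ConvexNormals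

variable {E : Type*} [NormedAddCommGroup E] [InnerProductSpace ℝ E]

/-- The normal cone of convex analysis: all `η` with `⟪η, z' - z⟫ ≤ 0` for every `z' ∈ D`. -/
def convexNormalCone (D : Set E) (z : E) : Set E := {η | ∀ z' ∈ D, inner ℝ η (z' - z) ≤ 0}

theorem convexNormalCone_subset_regularNormalCone (D : Set E) (z : E) :
    convexNormalCone D z ⊆ regularNormalCone D z := by
  intro η hη ε hε
  filter_upwards [self_mem_nhdsWithin] with z' hz'
  exact (hη z' hz').trans (by positivity)

theorem regularNormalCone_subset_limitingNormalCone {C : Set E} {x : E} (hx : x ∈ C) :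
    regularNormalCone C x ⊆ limitingNormalCone C x := fun η hη =>
  ⟨fun _ => x, fun _ => η, tendsto_const_nhds, tendsto_const_nhds, fun _ => ⟨hx, hη⟩⟩

theorem regularNormalCone_subset_convexNormalCone {D : Set E} (hD : Convex ℝ D) {z : E}
    (hz : z ∈ D) : regularNormalCone D z ⊆ convexNormalCone D z := by
  intro η hη z' hz'
  refine le_of_forall_pos_le_add fun δ hδ => ?_
  have hpos : 0 < δ / (‖z' - z‖ + 1) := by positivity
  have h := hη _ hpos
  have hlim : Tendsto (fun s : ℝ => z + s • (z' - z)) (𝓝[>] 0) (𝓝[D] z) := by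
    refine tendsto_nhdsWithin_iff.2 ⟨?_, ?_⟩
    · have : Continuous fun s : ℝ => z + s • (z' - z) := by fun_prop
      have h0 := this.tendsto 0
      simp only [zero_smul, add_zero] at h0
      exact h0.mono_left nhdsWithin_le_nhds
    · filter_upwards [Ioo_mem_nhdsGT (zero_lt_one' ℝ)] with s hs
      exact hD.add_smul_sub_mem hz hz' ⟨hs.1.le, hs.2.le⟩
  obtain ⟨s, hs, hs0⟩ := ((hlim.eventually h).and self_mem_nhdsWithin).exists
  have hs0 : (0 : ℝ) < s := hs0
  rw [add_sub_cancel_left, inner_smul_right, norm_smul, Real.norm_of_nonneg hs0.le] at hs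
  have h1 : inner ℝ η (z' - z) ≤ δ / (‖z' - z‖ + 1) * ‖z' - z‖ := by
    refine le_of_mul_le_mul_left ?_ hs0
    linarith
  have h2 : δ / (‖z' - z‖ + 1) * ‖z' - z‖ ≤ δ := by
    rw [div_mul_eq_mul_div, div_le_iff₀ (by positivity)]
    nlinarith [norm_nonneg (z' - z)]
  linarith

theorem mem_limitingNormalCone_iff_of_convex {D : Set E} (hD : Convex ℝ D) {z η : E}
    (hz : z ∈ D) : η ∈ limitingNormalCone D z ↔ η ∈ convexNormalCone D z := by
  refine ⟨?_, fun h => regularNormalCone_subset_limitingNormalCone hz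
    (convexNormalCone_subset_regularNormalCone D z h)⟩
  rintro ⟨xk, ηk, hx, hη, hk⟩ z' hz'
  refine le_of_tendsto (hη.inner (tendsto_const_nhds.sub hx)) (Eventually.of_forall fun k => ?_)
  exact regularNormalCone_subset_convexNormalCone hD (hk k).1 (hk k).2 z' hz'

end ConvexNormals

/-! ### Normals to preimages of convex sets -/

section Preimage

variable {X Z : Type*} [NormedAddCommGroup X] [InnerProductSpace ℝ X]
  [NormedAddCommGroup Z] [InnerProductSpace ℝ Z]

/-- The pullback of a normal of `D` under the derivative of `G` is a regular normal of `G⁻¹(D)`;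
no qualification condition is needed here. -/
theorem pullback_mem_regularNormalCone {G : X → Z} {G' : X →L[ℝ] Z} {D : Set Z} {x v : X} {η : Z}
    (hG : HasFDerivAt G G' x) (hη : η ∈ convexNormalCone D (G x))
    (hv : ∀ d, inner ℝ v d = inner ℝ η (G' d)) : v ∈ regularNormalCone (G ⁻¹' D) x := by
  intro ε hε
  have hlo := hG.isLittleO.def (c := ε / (‖η‖ + 1)) (by positivity)
  filter_upwards [self_mem_nhdsWithin, nhdsWithin_le_nhds hlo] with x' hx' hlo
  have h1 : inner ℝ η (G x' - G x) ≤ 0 := hη _ hx'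
  have h2 : inner ℝ v (x' - x) =
      inner ℝ η (G x' - G x) - inner ℝ η (G x' - G x - G' (x' - x)) := by
    rw [hv, ← inner_sub_right, sub_sub_cancel]
  have h3 := abs_le.1 (abs_real_inner_le_norm η (G x' - G x - G' (x' - x)))
  have h4 : ‖η‖ * ‖G x' - G x - G' (x' - x)‖ ≤ ‖η‖ * (ε / (‖η‖ + 1) * ‖x' - x‖) := by gcongr
  have h5 : ‖η‖ * (ε / (‖η‖ + 1) * ‖x' - x‖) ≤ ε * ‖x' - x‖ := by
    rw [← mul_assoc]
    gcongr
    rw [mul_div_assoc', div_le_iff₀ (by positivity)]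
    nlinarith [norm_nonneg η]
  linarith [h3.1]

/-- First-order optimality at a point that is a local minimizer up to the perturbation
`ε * ‖· - x‖`. -/
theorem neg_mul_norm_le_fderiv_of_eventually {ψ : X → ℝ} {ψ' : X →L[ℝ] ℝ} {x : X} {ε : ℝ}
    (hψ : HasFDerivAt ψ ψ' x) (hmin : ∀ᶠ x' in 𝓝 x, ψ x - ε * ‖x' - x‖ ≤ ψ x') (d : X) :
    -(ε * ‖d‖) ≤ ψ' d := by
  have hc : Tendsto (fun n : ℕ => ‖((n : ℝ) + 1)‖) atTop atTop :=
    tendsto_norm_atTop_atTop.comp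
      (tendsto_atTop_add_const_right _ _ tendsto_natCast_atTop_atTop)
  have hinv : Tendsto (fun n : ℕ => ((n : ℝ) + 1)⁻¹) atTop (𝓝 0) := by
    simpa [one_div] using tendsto_one_div_add_atTop_nhds_zero_nat (𝕜 := ℝ)
  have hpt : Tendsto (fun n : ℕ => x + ((n : ℝ) + 1)⁻¹ • d) atTop (𝓝 x) := by
    simpa using tendsto_const_nhds.add (hinv.smul_const d)
  refine ge_of_tendsto (hψ.lim d hc) ?_
  filter_upwards [hpt.eventually hmin] with n hn
  have hpos : (0 : ℝ) < n + 1 := by positivity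
  rw [add_sub_cancel_left, norm_smul, norm_inv, Real.norm_of_nonneg hpos.le] at hn
  rw [smul_eq_mul]
  have : ((n : ℝ) + 1) * (-(ε * (((n : ℝ) + 1)⁻¹ * ‖d‖))) = -(ε * ‖d‖) := by
    field_simp
  rw [← this]
  exact mul_le_mul_of_nonneg_left (by linarith) hpos.le

variable [FiniteDimensional ℝ X] [FiniteDimensional ℝ Z]

/-- Fuzzy normal cone rule for a preimage `G⁻¹(D)`: a regular normal `v` at `x` is, up to `ε`, the
pullback of a normal of `D` at points near `x` and `G x`. The point `x` is the unique minimizer of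
`-⟪v, · - x⟫ + ε ‖· - x‖` over `G⁻¹(D)` near `x`; the constraint is penalized by
`j ‖G x' - z‖²` with `z ∈ D`, and for large `j` the optimality conditions in `x'` and in `z` give
the two claims about `η = 2 j (G x' - z)`. -/
theorem exists_approx_pullback_of_mem_regularNormalCone {G : X → Z} {G' : X → X →L[ℝ] Z}
    {D : Set Z} (hG : ∀ x, HasFDerivAt G (G' x) x) (hDc : IsClosed D) (hD : Convex ℝ D)
    {x v : X} (hx : G x ∈ D) (hv : v ∈ regularNormalCone (G ⁻¹' D) x) {ε : ℝ} (hε : 0 < ε) :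
    ∃ (x' : X) (z η : Z), ‖x' - x‖ < ε ∧ z ∈ D ∧ ‖z - G x‖ < ε ∧ η ∈ convexNormalCone D z ∧
      ∀ d, inner ℝ v d - inner ℝ η (G' x' d) ≤ ε * ‖d‖ := by
  have hGc : Continuous G := continuous_iff_continuousAt.2 fun x => (hG x).continuousAt
  obtain ⟨δ, hδ, hδv⟩ : ∃ δ > 0, ∀ x', dist x' x ≤ δ → G x' ∈ D →
      inner ℝ v (x' - x) ≤ ε / 2 * ‖x' - x‖ := by
    obtain ⟨δ, hδ, h⟩ := Metric.eventually_nhds_iff.1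
      (eventually_nhdsWithin_iff.1 (hv (ε / 2) (by positivity)))
    exact ⟨δ / 2, by positivity, fun x' hx' hD' => h (by linarith) hD'⟩
  set K : Set (X × Z) := Metric.closedBall x δ ×ˢ (D ∩ Metric.closedBall (G x) 1)
  have hKc : IsCompact K :=
    (isCompact_closedBall x δ).prod ((isCompact_closedBall (G x) 1).inter_left hDc)
  have hxK : (x, G x) ∈ K := ⟨Metric.mem_closedBall_self hδ.le, hx,
    Metric.mem_closedBall_self zero_le_one⟩
  let φ : ℕ → X × Z → ℝ := fun j p =>
    -inner ℝ v (p.1 - x) + ε * ‖p.1 - x‖ + j * ‖G p.1 - p.2‖ ^ 2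
  have hφc : ∀ j, Continuous (φ j) := fun j => by fun_prop
  choose p hpK hpmin using fun j => hKc.exists_isMinOn ⟨_, hxK⟩ (hφc j).continuousOn
  have hp0 : ∀ j, φ j (p j) ≤ 0 := fun j => by
    have := isMinOn_iff.1 (hpmin j) _ hxK
    simpa [φ] using this
  obtain ⟨q, hqK, σ, hσ, hq⟩ := hKc.tendsto_subseq hpK
  have hq1 : Tendsto (fun j => (p (σ j)).1) atTop (𝓝 q.1) := (continuous_fst.tendsto q).comp hq
  have hq2 : Tendsto (fun j => (p (σ j)).2) atTop (𝓝 q.2) := (continuous_snd.tendsto q).comp hq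
  have hlin : Tendsto (fun j => -inner ℝ v ((p (σ j)).1 - x) + ε * ‖(p (σ j)).1 - x‖) atTop
      (𝓝 (-inner ℝ v (q.1 - x) + ε * ‖q.1 - x‖)) :=
    (tendsto_const_nhds.inner (hq1.sub_const x)).neg.add
      ((hq1.sub_const x).norm.const_mul ε)
  have hpen : Tendsto (fun j => ‖G (p (σ j)).1 - (p (σ j)).2‖ ^ 2) atTop
      (𝓝 (‖G q.1 - q.2‖ ^ 2)) :=
    ((((hGc.tendsto _).comp hq1).sub hq2).norm).pow 2
  -- the penalty term stays bounded while its factor tends to infinity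
  have hGq : G q.1 = q.2 := by
    by_contra hne
    have hpos : 0 < ‖G q.1 - q.2‖ ^ 2 := by
      have := norm_pos_iff.2 (sub_ne_zero.2 hne)
      positivity
    have hinf : Tendsto (fun j => (-inner ℝ v ((p (σ j)).1 - x) + ε * ‖(p (σ j)).1 - x‖) +
        (σ j : ℝ) * ‖G (p (σ j)).1 - (p (σ j)).2‖ ^ 2) atTop atTop :=
      tendsto_atTop_add_left_of_le' _ _ (hlin.eventually (Ici_mem_nhds (sub_one_lt _)))
        ((tendsto_natCast_atTop_atTop.comp hσ.tendsto_atTop).atTop_mul_pos hpos hpen)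
    obtain ⟨j, hj⟩ := (hinf.eventually_gt_atTop 0).exists
    exact absurd (hp0 (σ j)) (not_le.2 hj)
  -- the factor `ε` in `φ` against `ε / 2` in `hδv` makes `x` the only feasible minimizer
  have hqx : q.1 = x := by
    have h1 : -inner ℝ v (q.1 - x) + ε * ‖q.1 - x‖ ≤ 0 := by
      refine le_of_tendsto hlin (Eventually.of_forall fun j => ?_)
      have h0 : 0 ≤ (σ j : ℝ) * ‖G (p (σ j)).1 - (p (σ j)).2‖ ^ 2 := by positivity
      have := hp0 (σ j)
      simp only [φ] at this
      linarith
    have h2 := hδv q.1 hqK.1 (hGq ▸ hqK.2.1)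
    have h3 : ‖q.1 - x‖ ≤ 0 := by nlinarith [norm_nonneg (q.1 - x)]
    exact sub_eq_zero.1 (norm_le_zero_iff.1 h3)
  have hqz : q.2 = G x := by rw [← hGq, hqx]
  rw [hqx] at hq1
  rw [hqz] at hq2
  obtain ⟨j, ⟨hj1, hj2⟩⟩ := ((hq1.eventually (Metric.ball_mem_nhds x (lt_min hδ hε))).and
    (hq2.eventually (Metric.ball_mem_nhds (G x) (lt_min one_pos hε)))).exists
  rw [lt_min_iff] at hj1 hj2
  set x' := (p (σ j)).1
  set z := (p (σ j)).2
  set c : ℝ := (σ j : ℝ)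
  have hc0 : 0 ≤ c := Nat.cast_nonneg _
  have hzD : z ∈ D := (hpK (σ j)).2.1
  have hmin : ∀ y w, (y, w) ∈ K → -inner ℝ v (x' - x) + ε * ‖x' - x‖ + c * ‖G x' - z‖ ^ 2 ≤
      -inner ℝ v (y - x) + ε * ‖y - x‖ + c * ‖G y - w‖ ^ 2 :=
    fun y w h => isMinOn_iff.1 (hpmin (σ j)) _ h
  refine ⟨x', z, (2 * c) • (G x' - z), by rw [← dist_eq_norm]; exact hj1.2, hzD,
    by rw [← dist_eq_norm]; exact hj2.2, ?_, fun d => ?_⟩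
  -- optimality in `z`, where convexity of `D` turns a local statement into a global one
  · refine regularNormalCone_subset_convexNormalCone hD hzD fun ρ hρ => ?_
    have hnear : ∀ᶠ w in 𝓝 z, w ∈ Metric.ball (G x) 1 := Metric.isOpen_ball.mem_nhds hj2.1
    have hsmall : ∀ᶠ w in 𝓝 z, w ∈ Metric.ball z (ρ / (c + 1)) :=
      Metric.ball_mem_nhds z (by positivity)
    filter_upwards [self_mem_nhdsWithin, nhdsWithin_le_nhds hnear, nhdsWithin_le_nhds hsmall]
      with w hw hw1 hw2
    have h1 := hmin x' w ⟨(hpK (σ j)).1, hw, Metric.ball_subset_closedBall hw1⟩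
    have h2 : ‖G x' - w‖ ^ 2 =
        ‖G x' - z‖ ^ 2 - 2 * inner ℝ (G x' - z) (w - z) + ‖w - z‖ ^ 2 := by
      rw [← norm_sub_sq_real, sub_sub_sub_cancel_right]
    rw [h2] at h1
    rw [inner_smul_left]
    simp only [conj_trivial]
    rw [Metric.mem_ball, dist_eq_norm, lt_div_iff₀ (by positivity)] at hw2
    have h3 : c * ‖w - z‖ ≤ ρ := by nlinarith [norm_nonneg (w - z)]
    have h4 : c * ‖w - z‖ * ‖w - z‖ ≤ ρ * ‖w - z‖ := by gcongr
    nlinarith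
  -- optimality in `x'`, with the nonsmooth term bounded by `ε * ‖· - x'‖`
  · have hder : HasFDerivAt (fun y => -inner ℝ v (y - x) + c * ‖G y - z‖ ^ 2)
        (-(innerSL ℝ v) + c • (2 • (innerSL ℝ (G x' - z)).comp (G' x'))) x' := by
      refine HasFDerivAt.add ?_ (((hG x').sub_const z).norm_sq.const_mul c)
      exact ((innerSL ℝ v).hasFDerivAt.comp x' ((hasFDerivAt_id x').sub_const x)).neg
    have hloc : ∀ᶠ y in 𝓝 x', y ∈ Metric.ball x δ := Metric.isOpen_ball.mem_nhds hj1.1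
    have h := neg_mul_norm_le_fderiv_of_eventually hder (ε := ε) (by
      filter_upwards [hloc] with y hy
      have h1 := hmin y z ⟨Metric.ball_subset_closedBall hy, (hpK (σ j)).2⟩
      have h2 : ‖y - x‖ ≤ ‖y - x'‖ + ‖x' - x‖ := norm_sub_le_norm_sub_add_norm_sub _ _ _
      have h3 := mul_le_mul_of_nonneg_left h2 hε.le
      linarith) d
    have h2 : inner ℝ ((2 * c) • (G x' - z)) (G' x' d) =
        c * (2 * inner ℝ (G x' - z) (G' x' d)) := by
      rw [inner_smul_left]; simp only [conj_trivial]; ring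
    simp only [add_apply, neg_apply, innerSL_apply_apply, smul_apply,
      ContinuousLinearMap.comp_apply, smul_eq_mul, nsmul_eq_mul,
      Nat.cast_ofNat] at h
    rw [h2]
    linarith

/-- Normal cone rule for the preimage of a closed convex set under a qualification condition.
The multipliers `ηₖ` of the fuzzy rule are scaled by `sₖ = 1 / (1 + ‖ηₖ‖)`, so that
`(sₖ, sₖ ηₖ)` has a cluster point `(s, η)` with `‖η‖ = 1 - s`; the qualification condition
excludes `s = 0`. -/
theorem exists_pullback_of_mem_limitingNormalCone {G : X → Z} {G' : X → X →L[ℝ] Z}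
    {D : Set Z} (hG : ∀ x, HasFDerivAt G (G' x) x) (hG' : ∀ d, Continuous fun x => G' x d)
    (hDc : IsClosed D) (hD : Convex ℝ D) {x v : X}
    (hcq : ∀ η ∈ convexNormalCone D (G x), (∀ d, inner ℝ η (G' x d) = 0) → η = 0)
    (hv : v ∈ limitingNormalCone (G ⁻¹' D) x) :
    ∃ η ∈ convexNormalCone D (G x), ∀ d, inner ℝ v d = inner ℝ η (G' x d) := by
  have hGc : Continuous G := continuous_iff_continuousAt.2 fun x => (hG x).continuousAt
  obtain ⟨xk, vk, hxk, hvk, hk⟩ := hv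
  choose x' z η hx' hzD hz hη hd using fun k : ℕ =>
    exists_approx_pullback_of_mem_regularNormalCone hG hDc hD (hk k).1 (hk k).2
      (Nat.one_div_pos_of_nat (α := ℝ) (n := k))
  have hε := tendsto_one_div_add_atTop_nhds_zero_nat (𝕜 := ℝ)
  have hx'lim : Tendsto x' atTop (𝓝 x) := by
    have h : Tendsto (fun k => x' k - xk k) atTop (𝓝 0) :=
      squeeze_zero_norm (fun k => (hx' k).le) hε
    simpa using h.add hxk
  have hzlim : Tendsto z atTop (𝓝 (G x)) := by
    have h : Tendsto (fun k => z k - G (xk k)) atTop (𝓝 0) :=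
      squeeze_zero_norm (fun k => (hz k).le) hε
    simpa using h.add ((hGc.tendsto x).comp hxk)
  let s : ℕ → ℝ := fun k => 1 / (1 + ‖η k‖)
  have hs0 : ∀ k, 0 < s k := fun k => by positivity
  have hsη : ∀ k, ‖s k • η k‖ = 1 - s k := fun k => by
    rw [norm_smul, Real.norm_of_nonneg (hs0 k).le]
    have : (1 + ‖η k‖) ≠ 0 := by positivity
    simp only [s]
    field_simp
    ring
  have hs1 : ∀ k, s k ≤ 1 := fun k => by linarith [hsη k, norm_nonneg (s k • η k)]
  obtain ⟨⟨t, ζ⟩, -, σ, hσ, hlim⟩ := tendsto_subseq_of_bounded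
    (s := Metric.closedBall (0 : ℝ × Z) 1) Metric.isBounded_closedBall
    (x := fun k => (s k, s k • η k)) (fun k => by
      rw [mem_closedBall_zero_iff, Prod.norm_def, max_le_iff, hsη, Real.norm_of_nonneg (hs0 k).le]
      exact ⟨hs1 k, by linarith [hs0 k]⟩)
  have hst : Tendsto (fun k => s (σ k)) atTop (𝓝 t) := (continuous_fst.tendsto _).comp hlim
  have hζ : Tendsto (fun k => s (σ k) • η (σ k)) atTop (𝓝 ζ) :=
    (continuous_snd.tendsto _).comp hlim
  have ht0 : 0 ≤ t := ge_of_tendsto' hst fun k => (hs0 _).le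
  have hnorm : ‖ζ‖ = 1 - t := by
    refine tendsto_nhds_unique hζ.norm ?_
    simp only [hsη]
    exact tendsto_const_nhds.sub hst
  have hζN : ζ ∈ convexNormalCone D (G x) := fun w hw => by
    refine le_of_tendsto' (hζ.inner (tendsto_const_nhds.sub (hzlim.comp hσ.tendsto_atTop)))
      fun k => ?_
    rw [inner_smul_left]
    exact mul_nonpos_of_nonneg_of_nonpos (hs0 _).le (hη (σ k) w hw)
  have hle : ∀ d, t * inner ℝ v d - inner ℝ ζ (G' x d) ≤ 0 := fun d => by
    have hl : Tendsto (fun k => s (σ k) * inner ℝ (vk (σ k)) d -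
        inner ℝ (s (σ k) • η (σ k)) (G' (x' (σ k)) d)) atTop
        (𝓝 (t * inner ℝ v d - inner ℝ ζ (G' x d))) :=
      (hst.mul ((hvk.comp hσ.tendsto_atTop).inner tendsto_const_nhds)).sub
        (hζ.inner (((hG' d).tendsto x).comp (hx'lim.comp hσ.tendsto_atTop)))
    have hr : Tendsto (fun k => 1 / ((σ k : ℝ) + 1) * ‖d‖) atTop (𝓝 (0 * ‖d‖)) :=
      (hε.comp hσ.tendsto_atTop).mul_const _
    rw [zero_mul] at hr
    refine le_of_tendsto_of_tendsto' hl hr fun k => ?_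
    rw [inner_smul_left, conj_trivial, ← mul_sub]
    refine le_trans (mul_le_mul_of_nonneg_left (hd (σ k) d) (hs0 _).le) ?_
    exact mul_le_of_le_one_left (by positivity) (hs1 _)
  have heq : ∀ d, t * inner ℝ v d = inner ℝ ζ (G' x d) := fun d => by
    have h1 := hle d
    have h2 := hle (-d)
    simp only [map_neg, inner_neg_right] at h2
    linarith
  have htpos : 0 < t := by
    refine lt_of_le_of_ne ht0 fun h => ?_
    have hζ0 := hcq ζ hζN fun d => by rw [← heq d, ← h, zero_mul]
    rw [hζ0, norm_zero, ← h] at hnorm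
    norm_num at hnorm
  refine ⟨t⁻¹ • ζ, fun w hw => ?_, fun d => ?_⟩
  · rw [inner_smul_left]
    exact mul_nonpos_of_nonneg_of_nonpos (inv_nonneg.2 ht0) (hζN w hw)
  · rw [inner_smul_left, conj_trivial, ← heq d, inv_mul_cancel_left₀ htpos.ne']

end Preimage

/-! ### Epigraphs and extended reals -/

section ExtendedReal

theorem EReal_coe_add_le_coe_iff (a b : ℝ) (x : EReal) :
    (a : EReal) + x ≤ b ↔ x ≤ ((b - a : ℝ) : EReal) := by
  induction x with
  | bot => simp [-EReal.coe_sub]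
  | top => simp [-EReal.coe_sub, EReal.coe_ne_top]
  | coe x => norm_cast; constructor <;> intro h <;> linarith

theorem EReal_coe_add_eq_coe_iff (a b : ℝ) (x : EReal) :
    (a : EReal) + x = b ↔ x = ((b - a : ℝ) : EReal) := by
  induction x with
  | bot => simp [-EReal.coe_sub]
  | top => simp [-EReal.coe_sub]
  | coe x => norm_cast; constructor <;> intro h <;> linarith

end ExtendedReal

section Epigraph

/-- The map whose preimage of `epi g` is the epigraph of `φ + g ∘ Ψ`. -/
def epiMap {P F : Type*} (φ : P → ℝ) (Ψ : P → F) : EProd P ℝ → EProd F ℝ :=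
  fun q => pair (Ψ q.fst) (q.snd - φ q.fst)

theorem epigraph_add_comp {P F : Type*} (φ : P → ℝ) (Ψ : P → F) (g : F → EReal) :
    epigraph (fun p => (φ p : EReal) + g (Ψ p)) = epiMap φ Ψ ⁻¹' epigraph g :=
  Set.ext fun _ => EReal_coe_add_le_coe_iff _ _ _

theorem isClosed_epigraph_of_lowerSemicontinuous {F : Type*} [NormedAddCommGroup F]
    {g : F → EReal} (hg : LowerSemicontinuous g) :
    IsClosed (epigraph g) := by
  have hc : Continuous fun p : EProd F ℝ => ((p.fst, (p.snd : EReal)) : F × EReal) :=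
    (WithLp.continuous_fst 2 F ℝ).prodMk
      (continuous_coe_real_ereal.comp (WithLp.continuous_snd 2 F ℝ))
  exact hg.isClosed_epigraph.preimage hc

end Epigraph

/-! ### Subgradients of convex functions -/

section ConvexSubdifferential

variable {F : Type*} [NormedAddCommGroup F] [InnerProductSpace ℝ F]

theorem pair_mem_convexNormalCone_epigraph_iff {g : F → EReal} {z y : F} {α μ : ℝ} :
    pair y μ ∈ convexNormalCone (epigraph g) (pair z α) ↔
      ∀ (w : F) (β : ℝ), g w ≤ β → inner ℝ y (w - z) + μ * (β - α) ≤ 0 := by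
  have key : ∀ (w : F) (β : ℝ), inner ℝ (pair y μ) (pair w β - pair z α) =
      inner ℝ y (w - z) + μ * (β - α) := fun w β => by
    rw [WithLp.prod_inner_apply]
    simp [mul_comm]
  exact ⟨fun h w β hw => key w β ▸ h (pair w β) hw, fun h p hp => by
    have := h p.fst p.snd hp
    rwa [← key] at this⟩

theorem mem_limitingSubdiff_iff_of_isConvexFun {g : F → EReal} (hg : IsConvexFun g) {z y : F} :
    y ∈ limitingSubdiff g z ↔
      ∃ α : ℝ, g z = α ∧ ∀ (w : F) (β : ℝ), g w ≤ β → inner ℝ y (w - z) ≤ β - α := by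
  refine exists_congr fun α => and_congr_right fun hα => ?_
  rw [mem_limitingNormalCone_iff_of_convex hg (show pair z α ∈ epigraph g from hα.le),
    pair_mem_convexNormalCone_epigraph_iff]
  refine forall₃_congr fun w β _ => ?_
  constructor <;> intro h <;> linarith

theorem mem_singularSubdiff_of_isConvexFun {g : F → EReal} (hg : IsConvexFun g) {z y : F}
    {α : ℝ} (hα : g z = α) (hy : ∀ (w : F) (β : ℝ), g w ≤ β → inner ℝ y (w - z) ≤ 0) :
    y ∈ singularSubdiff g z := by
  refine ⟨α, hα, ?_⟩
  rw [mem_limitingNormalCone_iff_of_convex hg (show pair z α ∈ epigraph g from hα.le),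
    pair_mem_convexNormalCone_epigraph_iff]
  intro w β hw
  linarith [hy w β hw]

/-- The graph of the subdifferential of a proper lower semicontinuous convex function is closed.
Finiteness of `g` at the limit comes from the subgradient inequality at a fixed point of the
domain. -/
theorem mem_limitingSubdiff_of_tendsto {g : F → EReal} (hp : IsProper g)
    (hl : LowerSemicontinuous g) (hg : IsConvexFun g) {zk yk : ℕ → F} {z y : F}
    (hz : Tendsto zk atTop (𝓝 z)) (hy : Tendsto yk atTop (𝓝 y))
    (hk : ∀ k, yk k ∈ limitingSubdiff g (zk k)) : y ∈ limitingSubdiff g z := by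
  simp only [mem_limitingSubdiff_iff_of_isConvexFun hg] at hk ⊢
  choose α hα hsub using hk
  have key : ∀ (w : F) (β : ℝ), g w ≤ β → g z ≤ ((β - inner ℝ y (w - z) : ℝ) : EReal) := by
    intro w β hw
    have hlim : Tendsto (fun k => ((β - inner ℝ (yk k) (w - zk k) : ℝ) : EReal)) atTop
        (𝓝 ((β - inner ℝ y (w - z) : ℝ) : EReal)) :=
      (continuous_coe_real_ereal.tendsto _).comp
        (tendsto_const_nhds.sub (hy.inner (tendsto_const_nhds.sub hz)))
    refine le_of_forall_lt fun c hc => ?_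
    obtain ⟨c', hcc', hc'⟩ := exists_between hc
    refine hcc'.trans_le (ge_of_tendsto hlim ?_)
    filter_upwards [hz.eventually (hl z c' hc')] with k hk
    refine hk.le.trans ?_
    rw [hα k, EReal.coe_le_coe_iff]
    linarith [hsub k w β hw]
  obtain ⟨w₀, hw₀⟩ := hp.1
  have hw₀' : g w₀ = ((g w₀).toReal : EReal) :=
    (EReal.coe_toReal hw₀.ne (hp.2 w₀).ne').symm
  have hfin := key w₀ _ hw₀'.le
  have hα' : g z = ((g z).toReal : EReal) :=
    (EReal.coe_toReal (ne_top_of_le_ne_top (EReal.coe_ne_top _) hfin) (hp.2 z).ne').symm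
  refine ⟨(g z).toReal, hα', fun w β hw => ?_⟩
  have := key w β hw
  rw [hα', EReal.coe_le_coe_iff] at this
  linarith

end ConvexSubdifferential

/-! ### The chain rule for subdifferentials -/

section ChainRule

variable {P F : Type*} [NormedAddCommGroup P] [InnerProductSpace ℝ P]
  [NormedAddCommGroup F] [InnerProductSpace ℝ F]

/-- The derivative of `epiMap φ Ψ`, in terms of the derivatives of `φ` and `Ψ`. -/
def epiMapDeriv (φ' : P →L[ℝ] ℝ) (Ψ' : P →L[ℝ] F) : EProd P ℝ →L[ℝ] EProd F ℝ :=
  (WithLp.prodContinuousLinearEquiv 2 ℝ F ℝ).symm.toContinuousLinearMap.comp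
    ((Ψ'.comp (WithLp.fstL 2 ℝ P ℝ)).prod
      (WithLp.sndL 2 ℝ P ℝ - φ'.comp (WithLp.fstL 2 ℝ P ℝ)))

theorem epiMapDeriv_apply (φ' : P →L[ℝ] ℝ) (Ψ' : P →L[ℝ] F) (d : EProd P ℝ) :
    epiMapDeriv φ' Ψ' d = pair (Ψ' d.fst) (d.snd - φ' d.fst) := rfl

theorem hasFDerivAt_epiMap {φ : P → ℝ} {Ψ : P → F} {φ' : P →L[ℝ] ℝ} {Ψ' : P →L[ℝ] F}
    {q : EProd P ℝ} (hφ : HasFDerivAt φ φ' q.fst) (hΨ : HasFDerivAt Ψ Ψ' q.fst) :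
    HasFDerivAt (epiMap φ Ψ) (epiMapDeriv φ' Ψ') q := by
  have h1 := hΨ.comp q (WithLp.fstL 2 ℝ P ℝ).hasFDerivAt
  have h2 := hφ.comp q (WithLp.fstL 2 ℝ P ℝ).hasFDerivAt
  exact (WithLp.prodContinuousLinearEquiv 2 ℝ F ℝ).symm.toContinuousLinearMap.hasFDerivAt.comp q
    (h1.prodMk ((WithLp.sndL 2 ℝ P ℝ).hasFDerivAt.sub h2))

theorem inner_pair_epiMapDeriv (φ' : P →L[ℝ] ℝ) (Ψ' : P →L[ℝ] F) (y : F) (μ : ℝ)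
    (d : EProd P ℝ) : inner ℝ (pair y μ) (epiMapDeriv φ' Ψ' d) =
      inner ℝ y (Ψ' d.fst) + μ * (d.snd - φ' d.fst) := by
  rw [epiMapDeriv_apply, WithLp.prod_inner_apply]
  simp [mul_comm]

theorem inner_pair_left (v : P) (μ : ℝ) (d : EProd P ℝ) :
    inner ℝ (pair v μ) d = inner ℝ v d.fst + μ * d.snd := by
  rw [WithLp.prod_inner_apply]
  simp [mul_comm]

/-- The inclusion in the subdifferential chain rule that needs no qualification condition. -/
theorem mem_limitingSubdiff_add_comp {φ : P → ℝ} {Ψ : P → F} {φ' : P →L[ℝ] ℝ} {Ψ' : P →L[ℝ] F}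
    {g : F → EReal} (hg : IsConvexFun g) {p v : P} {y : F} (hφ : HasFDerivAt φ φ' p)
    (hΨ : HasFDerivAt Ψ Ψ' p) (hy : y ∈ limitingSubdiff g (Ψ p))
    (hv : ∀ d, inner ℝ v d = φ' d + inner ℝ y (Ψ' d)) :
    v ∈ limitingSubdiff (fun p => (φ p : EReal) + g (Ψ p)) p := by
  obtain ⟨α, hα, hn⟩ := hy
  have hmem : pair (Ψ p) α ∈ epigraph g := hα.le
  rw [mem_limitingNormalCone_iff_of_convex hg hmem] at hn
  have hG : epiMap φ Ψ (pair p (α + φ p)) = pair (Ψ p) α := by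
    simp [epiMap]
  refine ⟨α + φ p, (EReal_coe_add_eq_coe_iff _ _ _).2 (by rw [hα, add_sub_cancel_right]), ?_⟩
  rw [epigraph_add_comp]
  refine regularNormalCone_subset_limitingNormalCone ?_ ?_
  · rw [Set.mem_preimage, hG]
    exact hmem
  · refine pullback_mem_regularNormalCone (η := pair y (-1))
      (hasFDerivAt_epiMap (q := pair p (α + φ p)) hφ hΨ) (by rwa [hG]) fun d => ?_
    rw [inner_pair_epiMapDeriv, inner_pair_left, hv]
    ring

/-- Subdifferential chain rule for `φ + g ∘ Ψ` with `g` convex, under the basic qualification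
condition at `p`, written through the normal cone to the domain of `g`. -/
theorem exists_mem_limitingSubdiff_of_mem_add_comp [FiniteDimensional ℝ P]
    [FiniteDimensional ℝ F] {φ : P → ℝ} {Ψ : P → F} {φ' : P → P →L[ℝ] ℝ} {Ψ' : P → P →L[ℝ] F}
    {g : F → EReal} (hl : LowerSemicontinuous g) (hg : IsConvexFun g)
    (hφ : ∀ p, HasFDerivAt φ (φ' p) p) (hΨ : ∀ p, HasFDerivAt Ψ (Ψ' p) p)
    (hφ' : Continuous φ') (hΨ' : Continuous Ψ') {p v : P}
    (hcq : ∀ y, (∀ d, inner ℝ y (Ψ' p d) = 0) →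
      (∀ (w : F) (β : ℝ), g w ≤ β → inner ℝ y (w - Ψ p) ≤ 0) → y = 0)
    (hv : v ∈ limitingSubdiff (fun p => (φ p : EReal) + g (Ψ p)) p) :
    ∃ y ∈ limitingSubdiff g (Ψ p), ∀ d, inner ℝ v d = φ' p d + inner ℝ y (Ψ' p d) := by
  obtain ⟨α, hα, hn⟩ := hv
  rw [EReal_coe_add_eq_coe_iff] at hα
  rw [epigraph_add_comp] at hn
  have hmem : pair (Ψ p) (α - φ p) ∈ epigraph g := hα.le
  have hG : epiMap φ Ψ (pair p α) = pair (Ψ p) (α - φ p) := rfl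
  obtain ⟨η, hη, hd⟩ := exists_pullback_of_mem_limitingNormalCone
    (fun q => hasFDerivAt_epiMap (hφ q.fst) (hΨ q.fst))
    (fun d => by
      simp only [epiMapDeriv_apply]
      refine (WithLp.prod_continuous_toLp 2 F ℝ).comp (Continuous.prodMk ?_ ?_)
      · exact (hΨ'.comp (WithLp.continuous_fst 2 P ℝ)).clm_apply continuous_const
      · exact continuous_const.sub
          ((hφ'.comp (WithLp.continuous_fst 2 P ℝ)).clm_apply continuous_const))
    (isClosed_epigraph_of_lowerSemicontinuous hl) hg (x := pair p α) (by
      intro η hη hd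
      rw [hG] at hη
      obtain ⟨y, μ, rfl⟩ : ∃ y μ, η = pair y μ := ⟨η.fst, η.snd, rfl⟩
      simp only [inner_pair_epiMapDeriv] at hd
      -- the vertical direction shows that only horizontal normals are in question
      have hμ : μ = 0 := by simpa using hd (pair 0 1)
      subst hμ
      rw [pair_mem_convexNormalCone_epigraph_iff] at hη
      have hy := hcq y (fun d => by simpa using hd (pair d 0))
        (fun w β hw => by simpa using hη w β hw)
      rw [hy]
      rfl) hn
  rw [hG] at hη
  obtain ⟨y, μ, rfl⟩ : ∃ y μ, η = pair y μ := ⟨η.fst, η.snd, rfl⟩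
  replace hd : ∀ d : EProd P ℝ, inner ℝ v d.fst + -1 * d.snd =
      inner ℝ y (Ψ' p d.fst) + μ * (d.snd - φ' p d.fst) := fun d =>
    (inner_pair_left v (-1) d).symm.trans ((hd d).trans (inner_pair_epiMapDeriv _ _ y μ d))
  have hμ : μ = -1 := by simpa using (hd (pair 0 1)).symm
  subst hμ
  refine ⟨y, ⟨α - φ p, hα, (mem_limitingNormalCone_iff_of_convex hg hmem).2 hη⟩, fun d => ?_⟩
  have h : inner ℝ v d + -1 * 0 = inner ℝ y (Ψ' p d) + -1 * (0 - φ' p d) := hd (pair d 0)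
  linarith

end ChainRule

/-! ### Difference quotients along sequences -/

section Sequences

variable {E F : Type*} [NormedAddCommGroup E] [InnerProductSpace ℝ E]
  [NormedAddCommGroup F] [InnerProductSpace ℝ F]

theorem tendsto_clm_apply {A : ℕ → E →L[ℝ] F} {B : E →L[ℝ] F} {dk : ℕ → E} {d : E}
    (hA : Tendsto A atTop (𝓝 B)) (hd : Tendsto dk atTop (𝓝 d)) :
    Tendsto (fun k => A k (dk k)) atTop (𝓝 (B d)) :=
  ((isBoundedBilinearMap_apply (𝕜 := ℝ) (E := E) (F := F)).continuous.tendsto (B, d)).comp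
    (hA.prodMk_nhds hd)

/-- Hadamard form of the derivative along sequences of directions. -/
theorem tendsto_smul_sub_of_hasFDerivAt {G : E → F} {G' : E →L[ℝ] F} {x d : E}
    (hG : HasFDerivAt G G' x) {t : ℕ → ℝ} {dk : ℕ → E} (ht : TendsToZeroPos t)
    (hd : Tendsto dk atTop (𝓝 d)) :
    Tendsto (fun k => (t k)⁻¹ • (G (x + t k • dk k) - G x)) atTop (𝓝 (G' d)) := by
  refine hG.hasFDerivWithinAt.lim (s := Set.univ) (by simpa using ht.2.smul hd)
    (Eventually.of_forall fun _ => Set.mem_univ _) ?_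
  simpa [smul_smul, inv_mul_cancel₀ (ht.1 _).ne'] using hd

theorem tendsto_add_smul {x d : E} {t : ℕ → ℝ} {dk : ℕ → E} (ht : TendsToZeroPos t)
    (hd : Tendsto dk atTop (𝓝 d)) : Tendsto (fun k => x + t k • dk k) atTop (𝓝 x) := by
  simpa using tendsto_const_nhds.add (ht.2.smul hd)

end Sequences

/-! ### The gradient of the Lagrangian -/

section Lagrangian

variable {E F : Type*} [NormedAddCommGroup E] [InnerProductSpace ℝ E] [CompleteSpace E]
  [NormedAddCommGroup F] [InnerProductSpace ℝ F]
  {f₀ : E → ℝ} {Φ : E → F}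

theorem inner_gradient_lagrangian (hf₀ : Differentiable ℝ f₀) (hΦ : Differentiable ℝ Φ)
    (x : E) (y : F) (d : E) :
    inner ℝ (gradient (fun x' => lagrangian f₀ Φ x' y) x) d =
      fderiv ℝ f₀ x d + inner ℝ y (fderiv ℝ Φ x d) := by
  have h : HasFDerivAt (fun x' => lagrangian f₀ Φ x' y)
      (fderiv ℝ f₀ x + (innerSL ℝ y).comp (fderiv ℝ Φ x)) x :=
    (hf₀ x).hasFDerivAt.add ((innerSL ℝ y).hasFDerivAt.comp x (hΦ x).hasFDerivAt)
  rw [gradient, InnerProductSpace.toDual_symm_apply, h.fderiv]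
  rfl

theorem eq_gradient_lagrangian_iff (hf₀ : Differentiable ℝ f₀) (hΦ : Differentiable ℝ Φ)
    {x v : E} {y : F} : v = gradient (fun x' => lagrangian f₀ Φ x' y) x ↔
      ∀ d, inner ℝ v d = fderiv ℝ f₀ x d + inner ℝ y (fderiv ℝ Φ x d) := by
  simp only [← inner_gradient_lagrangian hf₀ hΦ]
  exact ⟨fun h d => by rw [h], ext_inner_right ℝ⟩

theorem gradient_lagrangian_eq_add_adjoint [CompleteSpace F] (hf₀ : Differentiable ℝ f₀)
    (hΦ : Differentiable ℝ Φ)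
    (x : E) (y y' : F) : gradient (fun x' => lagrangian f₀ Φ x' y') x =
      gradient (fun x' => lagrangian f₀ Φ x' y) x + (fderiv ℝ Φ x).adjoint (y' - y) := by
  refine ext_inner_right ℝ fun d => ?_
  rw [inner_add_left, inner_gradient_lagrangian hf₀ hΦ, inner_gradient_lagrangian hf₀ hΦ,
    ContinuousLinearMap.adjoint_inner_left, inner_sub_left]
  ring

theorem contDiff_gradient_lagrangian (hf₀ : ContDiff ℝ 2 f₀) (hΦ : ContDiff ℝ 2 Φ) (y : F) :
    ContDiff ℝ 1 (gradient fun x' => lagrangian f₀ Φ x' y) := by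
  have h : ContDiff ℝ 2 fun x' => lagrangian f₀ Φ x' y := hf₀.add (contDiff_const.inner ℝ hΦ)
  exact (InnerProductSpace.toDual ℝ E).symm.contDiff.comp
    (h.fderiv_right (m := 1) (by norm_num))

theorem hasFDerivAt_gradient_lagrangian (hf₀ : ContDiff ℝ 2 f₀) (hΦ : ContDiff ℝ 2 Φ) (x : E)
    (y : F) : HasFDerivAt (gradient fun x' => lagrangian f₀ Φ x' y)
      (lagrangianHess f₀ Φ x y) x :=
  ((contDiff_gradient_lagrangian hf₀ hΦ y).differentiable one_ne_zero x).hasFDerivAt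

theorem tendsto_adjoint_fderiv [CompleteSpace F] (hΦ : ContDiff ℝ 2 Φ) {xk : ℕ → E} {yk : ℕ → F} {x : E} {y : F}
    (hx : Tendsto xk atTop (𝓝 x)) (hy : Tendsto yk atTop (𝓝 y)) :
    Tendsto (fun k => (fderiv ℝ Φ (xk k)).adjoint (yk k)) atTop
      (𝓝 ((fderiv ℝ Φ x).adjoint y)) := by
  have h1 : Continuous fun x => (fderiv ℝ Φ x).adjoint :=
    (ContinuousLinearMap.adjoint (𝕜 := ℝ) (E := E) (F := F)).continuous.comp
      (hΦ.continuous_fderiv two_ne_zero)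
  have h2 : Tendsto (fun k => (fderiv ℝ Φ (xk k)).adjoint) atTop (𝓝 (fderiv ℝ Φ x).adjoint) :=
    (h1.tendsto x).comp hx
  exact tendsto_clm_apply h2 hy

end Lagrangian

/-! ### Multipliers and solutions -/

section Multipliers

variable {E F : Type*} [NormedAddCommGroup E] [InnerProductSpace ℝ E] [CompleteSpace E]
  [NormedAddCommGroup F] [InnerProductSpace ℝ F]
  {f₀ : E → ℝ} {Φ : E → F} {g : F → EReal}

theorem mem_solMap_of_mem_limitingSubdiff (hg : IsConvexFun g) (hf₀ : Differentiable ℝ f₀)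
    (hΦ : Differentiable ℝ Φ) {x : E} {u y : F} (hy : y ∈ limitingSubdiff g (Φ x + u)) :
    x ∈ solMap (compositeFun f₀ Φ g)
      (pair (gradient (fun x' => lagrangian f₀ Φ x' y) x) u) :=
  mem_limitingSubdiff_add_comp (Ψ := fun x' => Φ x' + u) hg (hf₀ x).hasFDerivAt
    ((hΦ x).hasFDerivAt.add_const u) hy (inner_gradient_lagrangian hf₀ hΦ x y)

/-- The basic qualification condition, with normals to the domain of `g` in place of singular
subgradients, persists at nearby parameters `(x, u)`: unit vectors that violate it have a cluster
point that violates it at `(xbar, 0)`. -/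
theorem BasicCQ.eventually [CompleteSpace F] [FiniteDimensional ℝ F] (hg : IsConvexFun g)
    (hΦ : ContDiff ℝ 2 Φ) {xbar : E} {α : ℝ}
    (hα : g (Φ xbar) = α) (hcq : BasicCQ Φ g xbar) :
    ∀ᶠ p : E × F in 𝓝 (xbar, 0), ∀ y, (∀ d, inner ℝ y (fderiv ℝ Φ p.1 d) = 0) →
      (∀ (w : F) (β : ℝ), g w ≤ β → inner ℝ y (w - (Φ p.1 + p.2)) ≤ 0) → y = 0 := by
  by_contra hcon
  obtain ⟨p, hp, hk⟩ := exists_seq_forall_of_frequently (not_eventually.1 hcon)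
  push Not at hk
  choose y hy1 hy2 hy0 using hk
  have hpos : ∀ k, 0 < ‖y k‖⁻¹ := fun k => inv_pos.2 (norm_pos_iff.2 (hy0 k))
  have hnorm : ∀ k, ‖‖y k‖⁻¹ • y k‖ = 1 := fun k => norm_smul_inv_norm (hy0 k)
  obtain ⟨ζ, -, σ, hσ, hζ⟩ := tendsto_subseq_of_bounded
    (s := Metric.closedBall (0 : F) 1) Metric.isBounded_closedBall
    (x := fun k => ‖y k‖⁻¹ • y k) (fun k => by
      rw [mem_closedBall_zero_iff, hnorm])
  have hp' := hp.comp hσ.tendsto_atTop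
  have hp1 : Tendsto (fun k => (p (σ k)).1) atTop (𝓝 xbar) :=
    (continuous_fst.tendsto _).comp hp'
  have hp2 : Tendsto (fun k => (p (σ k)).2) atTop (𝓝 0) := (continuous_snd.tendsto _).comp hp'
  have hζ1 : ‖ζ‖ = 1 := by
    refine tendsto_nhds_unique hζ.norm ?_
    simp only [Function.comp_def, hnorm]
    exact tendsto_const_nhds
  have hΦk : Tendsto (fun k => Φ (p (σ k)).1 + (p (σ k)).2) atTop (𝓝 (Φ xbar)) := by
    simpa using ((hΦ.continuous.tendsto _).comp hp1).add hp2
  have hζ0 : ζ = 0 := by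
    refine hcq ζ (ext_inner_right ℝ fun d => ?_) (mem_singularSubdiff_of_isConvexFun hg hα ?_)
    · rw [ContinuousLinearMap.adjoint_inner_left, inner_zero_left]
      have hder : Tendsto (fun k => fderiv ℝ Φ (p (σ k)).1 d) atTop (𝓝 (fderiv ℝ Φ xbar d)) :=
        (((hΦ.continuous_fderiv two_ne_zero).clm_apply continuous_const).tendsto _).comp hp1
      refine tendsto_nhds_unique (hζ.inner hder) ?_
      simp [inner_smul_left, hy1]
    · intro w β hw
      refine le_of_tendsto' (hζ.inner (tendsto_const_nhds.sub hΦk)) fun k => ?_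
      simp only [Function.comp_apply, inner_smul_left]
      exact mul_nonpos_of_nonneg_of_nonpos (hpos _).le (hy2 (σ k) w β hw)
  rw [hζ0, norm_zero] at hζ1
  exact zero_ne_one hζ1

variable [FiniteDimensional ℝ E] [FiniteDimensional ℝ F]

/-- The multiplier mapping in terms of the Lagrangian. The map `(x, u) ↦ Φ x + u` is a submersion,
so that the chain rule for `f` holds as an equality without any qualification condition. -/
theorem mem_multMap_iff (hl : LowerSemicontinuous g) (hg : IsConvexFun g)
    (hf₀ : ContDiff ℝ 2 f₀) (hΦ : ContDiff ℝ 2 Φ) {v x : E} {u y : F} :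
    y ∈ multMap (compositeFun f₀ Φ g) (pair v (pair u x)) ↔
      v = gradient (fun x' => lagrangian f₀ Φ x' y) x ∧ y ∈ limitingSubdiff g (Φ x + u) := by
  have hdf := hf₀.differentiable two_ne_zero
  have hdΦ := hΦ.differentiable two_ne_zero
  let fst := WithLp.fstL 2 ℝ E F
  let snd := WithLp.sndL 2 ℝ E F
  have h1 : ∀ p : EProd E F, HasFDerivAt (fun p => f₀ p.fst) ((fderiv ℝ f₀ p.fst).comp fst) p :=
    fun p => (hdf p.fst).hasFDerivAt.comp p fst.hasFDerivAt
  have h2 : ∀ p : EProd E F, HasFDerivAt (fun p => Φ p.fst + p.snd)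
      ((fderiv ℝ Φ p.fst).comp fst + snd) p :=
    fun p => ((hdΦ p.fst).hasFDerivAt.comp p fst.hasFDerivAt).add snd.hasFDerivAt
  rw [eq_gradient_lagrangian_iff hdf hdΦ]
  have hin : ∀ (y' : F) (d : EProd E F),
      inner ℝ (pair v y') d = inner ℝ v d.fst + inner ℝ y' d.snd :=
    fun y' d => WithLp.prod_inner_apply _ _
  constructor
  · intro hy
    obtain ⟨y', hy', hd⟩ := exists_mem_limitingSubdiff_of_mem_add_comp
      (φ := fun p : EProd E F => f₀ p.fst) (Ψ := fun p => Φ p.fst + p.snd)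
      (p := pair x u) (v := pair v y) hl hg h1 h2
      (((hf₀.continuous_fderiv two_ne_zero).comp fst.continuous).clm_comp continuous_const)
      ((((hΦ.continuous_fderiv two_ne_zero).comp fst.continuous).clm_comp
        continuous_const).add continuous_const)
      (fun y₀ hy₀ _ => ext_inner_right ℝ fun e => by
        simpa [fst, snd] using hy₀ (pair 0 e)) hy
    obtain rfl : y = y' := ext_inner_right ℝ fun e => by
      simpa [fst, snd, hin] using hd (pair 0 e)
    exact ⟨fun d => by simpa [fst, snd, hin] using hd (pair d 0), hy'⟩
  · rintro ⟨hv, hy⟩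
    refine mem_limitingSubdiff_add_comp (φ := fun p : EProd E F => f₀ p.fst)
      (Ψ := fun p => Φ p.fst + p.snd) hg (h1 (pair x u)) (h2 (pair x u)) hy fun d => ?_
    refine (hin y d).trans ?_
    simp [fst, snd, hv, inner_add_right, add_assoc]

theorem exists_mem_multMap_of_mem_solMap (hl : LowerSemicontinuous g) (hg : IsConvexFun g)
    (hf₀ : ContDiff ℝ 2 f₀) (hΦ : ContDiff ℝ 2 Φ) {v x : E} {u : F}
    (hcq : ∀ y, (∀ d, inner ℝ y (fderiv ℝ Φ x d) = 0) →
      (∀ (w : F) (β : ℝ), g w ≤ β → inner ℝ y (w - (Φ x + u)) ≤ 0) → y = 0)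
    (hx : x ∈ solMap (compositeFun f₀ Φ g) (pair v u)) :
    (multMap (compositeFun f₀ Φ g) (pair v (pair u x))).Nonempty := by
  have hdf := hf₀.differentiable two_ne_zero
  have hdΦ := hΦ.differentiable two_ne_zero
  obtain ⟨y, hy, hd⟩ := exists_mem_limitingSubdiff_of_mem_add_comp
    (Ψ := fun x' => Φ x' + u) hl hg (fun x' => (hdf x').hasFDerivAt)
    (fun x' => (hdΦ x').hasFDerivAt.add_const u) (hf₀.continuous_fderiv two_ne_zero)
    (hΦ.continuous_fderiv two_ne_zero) hcq hx
  exact ⟨y, (mem_multMap_iff hl hg hf₀ hΦ).2 ⟨(eq_gradient_lagrangian_iff hdf hdΦ).2 hd, hy⟩⟩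

end Multipliers

/-! ### Sequences in product spaces and isolated calmness -/

section Pairs

variable {E F : Type*} [NormedAddCommGroup E] [NormedAddCommGroup F]

theorem tendsto_pair {a : ℕ → E} {b : ℕ → F} {x : E} {y : F} (ha : Tendsto a atTop (𝓝 x))
    (hb : Tendsto b atTop (𝓝 y)) :
    Tendsto (fun k => pair (a k) (b k)) atTop (𝓝 (pair x y)) :=
  ((WithLp.prod_continuous_toLp 2 E F).tendsto (x, y)).comp (ha.prodMk_nhds hb)

theorem tendsto_fst_of_tendsto {p : ℕ → EProd E F} {q : EProd E F} (h : Tendsto p atTop (𝓝 q)) :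
    Tendsto (fun k => (p k).fst) atTop (𝓝 q.fst) :=
  ((WithLp.continuous_fst 2 E F).tendsto q).comp h

theorem tendsto_snd_of_tendsto {p : ℕ → EProd E F} {q : EProd E F} (h : Tendsto p atTop (𝓝 q)) :
    Tendsto (fun k => (p k).snd) atTop (𝓝 q.snd) :=
  ((WithLp.continuous_snd 2 E F).tendsto q).comp h

end Pairs

section IsolatedCalmness

variable {E F : Type*} [NormedAddCommGroup E] [InnerProductSpace ℝ E]
  [NormedAddCommGroup F] [InnerProductSpace ℝ F]

theorem pair_zero_add_smul (x : E) (t : ℝ) (d : EProd E (EProd F E)) :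
    (pair 0 (pair 0 x) : EProd E (EProd F E)) + t • d =
      pair (t • d.fst) (pair (t • d.snd.fst) (x + t • d.snd.snd)) := by
  refine WithLp.ofLp_injective 2 (Prod.ext (zero_add _) (WithLp.ofLp_injective 2
    (Prod.ext (zero_add _) rfl)))

/-- An isolatedly calm mapping admits no nonzero tangent direction of its graph over the zero
direction of the parameters. -/
theorem IsolatedlyCalmAt.eq_zero_of_tendsto {Υ : EProd E F → Set E} {x d : E}
    (h : IsolatedlyCalmAt Υ (pair 0 0) x) {t : ℕ → ℝ} {dk vk : ℕ → E} {uk : ℕ → F}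
    (ht : TendsToZeroPos t) (hd : Tendsto dk atTop (𝓝 d)) (hv : Tendsto vk atTop (𝓝 0))
    (hu : Tendsto uk atTop (𝓝 0))
    (hk : ∀ k, x + t k • dk k ∈ Υ (pair (t k • vk k) (t k • uk k))) : d = 0 := by
  obtain ⟨κ, -, V, hV, hcalm⟩ := h
  have hxk : Tendsto (fun k => x + t k • dk k) atTop (𝓝 x) := by
    simpa using tendsto_const_nhds.add (ht.2.smul hd)
  have hpair : Tendsto (fun k => κ * ‖pair (vk k) (uk k)‖) atTop (𝓝 0) := by
    have h0 : (pair 0 0 : EProd E F) = 0 := rfl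
    have := (tendsto_pair hv hu).norm.const_mul κ
    rwa [h0, norm_zero, mul_zero] at this
  refine norm_le_zero_iff.1 (le_of_tendsto_of_tendsto hd.norm hpair ?_)
  filter_upwards [hxk.eventually hV] with k hkV
  have h1 := hcalm _ _ ⟨hk k, hkV⟩
  have h2 : (pair (t k • vk k) (t k • uk k) : EProd E F) - pair 0 0 =
      t k • pair (vk k) (uk k) :=
    WithLp.ofLp_injective 2 (Prod.ext (sub_zero _) (sub_zero _))
  rw [h2, add_sub_cancel_left, norm_smul, norm_smul, Real.norm_of_nonneg (ht.1 k).le] at h1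
  refine le_of_mul_le_mul_left ?_ (ht.1 k)
  linarith

end IsolatedCalmness

/-! ### Isolated calmness, noncriticality and tangents to the domain of the multiplier mapping -/

section Characterization

variable {E F : Type*} [NormedAddCommGroup E] [InnerProductSpace ℝ E] [CompleteSpace E]
  [NormedAddCommGroup F] [InnerProductSpace ℝ F]
  [FiniteDimensional ℝ E] [FiniteDimensional ℝ F]
  {f₀ : E → ℝ} {Φ : E → F} {g : F → EReal}

/-- Isolated calmness of the solution mapping removes all directions `(0, 0, dx)`, `dx ≠ 0`, from
the tangent cone to the domain of the multiplier mapping, since this domain lies in the inverse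
graph of the solution mapping. -/
theorem IsolatedlyCalmAt.notMem_tangentCone_domOf_multMap (hl : LowerSemicontinuous g)
    (hg : IsConvexFun g) (hf₀ : ContDiff ℝ 2 f₀) (hΦ : ContDiff ℝ 2 Φ) {xbar dx : E}
    (hcalm : IsolatedlyCalmAt (solMap (compositeFun f₀ Φ g)) (pair 0 0) xbar) (hdx : dx ≠ 0) :
    pair 0 (pair 0 dx) ∉ tangentCone (domOf (multMap (compositeFun f₀ Φ g)))
      (pair 0 (pair 0 xbar)) := by
  rintro ⟨ck, t, hck, ht, hk⟩
  have hck2 := tendsto_snd_of_tendsto hck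
  refine hdx (hcalm.eq_zero_of_tendsto ht (tendsto_snd_of_tendsto hck2)
    (tendsto_fst_of_tendsto hck) (tendsto_fst_of_tendsto hck2) fun k => ?_)
  have hdom := hk k
  rw [pair_zero_add_smul] at hdom
  obtain ⟨y, hy⟩ := hdom
  obtain ⟨hv, hy⟩ := (mem_multMap_iff hl hg hf₀ hΦ).1 hy
  rw [hv]
  exact mem_solMap_of_mem_limitingSubdiff hg (hf₀.differentiable two_ne_zero)
    (hΦ.differentiable two_ne_zero) hy

variable [CompleteSpace F]

/-- A critical direction `(dx, dy)` produces parameters `(vₖ, uₖ) = o(tₖ)` at which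
`xbar + tₖ dx` is a solution. -/
theorem IsolatedlyCalmAt.isNoncritical (hl : LowerSemicontinuous g) (hg : IsConvexFun g)
    (hf₀ : ContDiff ℝ 2 f₀) (hΦ : ContDiff ℝ 2 Φ) {xbar : E} {ybar : F}
    (hcalm : IsolatedlyCalmAt (solMap (compositeFun f₀ Φ g)) (pair 0 0) xbar)
    (hy : ybar ∈ multMap (compositeFun f₀ Φ g) (pair 0 (pair 0 xbar))) :
    IsNoncritical f₀ Φ g xbar ybar := by
  have hdf := hf₀.differentiable two_ne_zero
  have hdΦ := hΦ.differentiable two_ne_zero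
  intro dx dy hdxy htan
  obtain ⟨hgrad, -⟩ := (mem_multMap_iff hl hg hf₀ hΦ).1 hy
  obtain ⟨ck, t, hck, ht, hk⟩ := htan
  have ha : Tendsto (fun k => (ck k).fst) atTop (𝓝 (fderiv ℝ Φ xbar dx)) :=
    tendsto_fst_of_tendsto hck
  have hb : Tendsto (fun k => (ck k).snd) atTop (𝓝 dy) := tendsto_snd_of_tendsto hck
  have hdx : Tendsto (fun _ : ℕ => dx) atTop (𝓝 dx) := tendsto_const_nhds
  have hΦlim := tendsto_smul_sub_of_hasFDerivAt (hdΦ xbar).hasFDerivAt ht hdx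
  have hglim := tendsto_smul_sub_of_hasFDerivAt
    (hasFDerivAt_gradient_lagrangian hf₀ hΦ xbar ybar) ht hdx
  have hadj := tendsto_adjoint_fderiv hΦ (tendsto_add_smul (x := xbar) ht hdx) hb
  refine hcalm.eq_zero_of_tendsto ht hdx
    (vk := fun k => (t k)⁻¹ • gradient (fun x' => lagrangian f₀ Φ x' (ybar + t k • (ck k).snd))
      (xbar + t k • dx))
    (uk := fun k => (ck k).fst - (t k)⁻¹ • (Φ (xbar + t k • dx) - Φ xbar)) ?_ ?_ fun k => ?_
  · have := hglim.add hadj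
    rw [hdxy] at this
    refine this.congr fun k => ?_
    rw [gradient_lagrangian_eq_add_adjoint hdf hdΦ _ ybar (ybar + _), ← hgrad, sub_zero,
      add_sub_cancel_left, map_smul, smul_add, smul_smul, inv_mul_cancel₀ (ht.1 k).ne', one_smul]
  · simpa using ha.sub hΦlim
  · rw [smul_smul, mul_inv_cancel₀ (ht.1 k).ne', one_smul]
    refine mem_solMap_of_mem_limitingSubdiff hg hdf hdΦ ?_
    rw [smul_sub, smul_smul, mul_inv_cancel₀ (ht.1 k).ne', one_smul]
    have harg : Φ (xbar + t k • dx) + (t k • (ck k).fst - (Φ (xbar + t k • dx) - Φ xbar)) =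
        Φ xbar + t k • (ck k).fst := by abel
    rw [harg]
    exact hk k

/-- Multipliers that approach a limit at the rate provided by inner calmness* yield, together with
the direction `dx` of the points they belong to, a solution of the criticality system at the limit
multiplier. -/
theorem eq_zero_of_multipliers (hp : IsProper g) (hl : LowerSemicontinuous g)
    (hg : IsConvexFun g) (hf₀ : ContDiff ℝ 2 f₀) (hΦ : ContDiff ℝ 2 Φ) {xbar dx : E} {y : F}
    (hnc : ∀ ybar ∈ multMap (compositeFun f₀ Φ g) (pair 0 (pair 0 xbar)),
      IsNoncritical f₀ Φ g xbar ybar)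
    {κ : ℝ} {t : ℕ → ℝ} {dk : ℕ → EProd E (EProd F E)} {yk : ℕ → F} (hκ : 0 < κ)
    (ht : TendsToZeroPos t) (hd : Tendsto dk atTop (𝓝 (pair 0 (pair 0 dx))))
    (hy : Tendsto yk atTop (𝓝 y))
    (hmem : ∀ k, yk k ∈ multMap (compositeFun f₀ Φ g) (pair 0 (pair 0 xbar) + t k • dk k))
    (hle : ∀ k, ‖yk k - y‖ ≤ κ * t k * ‖dk k‖) : dx = 0 := by
  have hdf := hf₀.differentiable two_ne_zero
  have hdΦ := hΦ.differentiable two_ne_zero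
  simp only [pair_zero_add_smul, mem_multMap_iff hl hg hf₀ hΦ] at hmem
  have hv : Tendsto (fun k => (dk k).fst) atTop (𝓝 0) := tendsto_fst_of_tendsto hd
  have hd2 := tendsto_snd_of_tendsto hd
  have hu : Tendsto (fun k => (dk k).snd.fst) atTop (𝓝 0) := tendsto_fst_of_tendsto hd2
  have hx : Tendsto (fun k => (dk k).snd.snd) atTop (𝓝 dx) := tendsto_snd_of_tendsto hd2
  have hxk := tendsto_add_smul (x := xbar) ht hx
  have hz : Tendsto (fun k => Φ (xbar + t k • (dk k).snd.snd) + t k • (dk k).snd.fst) atTop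
      (𝓝 (Φ xbar + 0)) := by
    refine ((hΦ.continuous.tendsto _).comp hxk).add ?_
    simpa using ht.2.smul hu
  have hysub : y ∈ limitingSubdiff g (Φ xbar + 0) :=
    mem_limitingSubdiff_of_tendsto hp hl hg hz hy fun k => (hmem k).2
  have hgrad : 0 = gradient (fun x' => lagrangian f₀ Φ x' y) xbar := by
    have h1 : Tendsto (fun k => t k • (dk k).fst) atTop (𝓝 0) := by simpa using ht.2.smul hv
    have h2 := (((contDiff_gradient_lagrangian hf₀ hΦ y).continuous.tendsto _).comp hxk).add
      (tendsto_adjoint_fderiv hΦ hxk (hy.sub_const y))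
    rw [sub_self, map_zero, add_zero] at h2
    refine tendsto_nhds_unique h1 (h2.congr fun k => ?_)
    rw [(hmem k).1, gradient_lagrangian_eq_add_adjoint hdf hdΦ _ y (yk k)]
    rfl
  have hybar : y ∈ multMap (compositeFun f₀ Φ g) (pair 0 (pair 0 xbar)) :=
    (mem_multMap_iff hl hg hf₀ hΦ).2 ⟨hgrad, hysub⟩
  -- the rate `hle` bounds the quotients `(yk - y) / t`, so they have a cluster point `dy`
  obtain ⟨B, hB⟩ := hd.norm.bddAbove_range
  obtain ⟨dy, -, σ, hσ, hdy⟩ := tendsto_subseq_of_bounded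
    (s := Metric.closedBall (0 : F) (κ * B)) Metric.isBounded_closedBall
    (x := fun k => (t k)⁻¹ • (yk k - y)) (fun k => by
      rw [mem_closedBall_zero_iff, norm_smul, norm_inv, Real.norm_of_nonneg (ht.1 k).le,
        inv_mul_le_iff₀ (ht.1 k)]
      have h1 : ‖dk k‖ ≤ B := hB ⟨k, rfl⟩
      have h2 := mul_le_mul_of_nonneg_left h1 (mul_pos hκ (ht.1 k)).le
      linarith [hle k])
  have hσt : TendsToZeroPos (t ∘ σ) := ⟨fun k => ht.1 _, ht.2.comp hσ.tendsto_atTop⟩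
  have hσx := hx.comp hσ.tendsto_atTop
  have hglim := tendsto_smul_sub_of_hasFDerivAt
    (hasFDerivAt_gradient_lagrangian hf₀ hΦ xbar y) hσt hσx
  have hΦlim := tendsto_smul_sub_of_hasFDerivAt (hdΦ xbar).hasFDerivAt hσt hσx
  have hadj := tendsto_adjoint_fderiv hΦ (tendsto_add_smul (x := xbar) hσt hσx) hdy
  refine hnc y hybar dx dy ?_ ?_
  · refine tendsto_nhds_unique ((hglim.add hadj).congr fun k => ?_) (hv.comp hσ.tendsto_atTop)
    have h := (hmem (σ k)).1
    rw [gradient_lagrangian_eq_add_adjoint hdf hdΦ _ y (yk (σ k))] at h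
    simp only [Function.comp_apply]
    rw [← hgrad, sub_zero, map_smul, ← smul_add, ← h, smul_smul,
      inv_mul_cancel₀ (ht.1 _).ne', one_smul]
  · refine ⟨fun k => pair ((t (σ k))⁻¹ • (Φ (xbar + t (σ k) • (dk (σ k)).snd.snd) - Φ xbar) +
      (dk (σ k)).snd.fst) ((t (σ k))⁻¹ • (yk (σ k) - y)), t ∘ σ, tendsto_pair ?_ hdy, hσt,
      fun k => ?_⟩
    · simpa using hΦlim.add (hu.comp hσ.tendsto_atTop)
    · have h := (hmem (σ k)).2
      have hne := (ht.1 (σ k)).ne'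
      have h1 : Φ xbar + t (σ k) • ((t (σ k))⁻¹ • (Φ (xbar + t (σ k) • (dk (σ k)).snd.snd) -
          Φ xbar) + (dk (σ k)).snd.fst) =
          Φ (xbar + t (σ k) • (dk (σ k)).snd.snd) + t (σ k) • (dk (σ k)).snd.fst := by
        rw [smul_add, smul_smul, mul_inv_cancel₀ hne, one_smul]
        abel
      have h2 : y + t (σ k) • ((t (σ k))⁻¹ • (yk (σ k) - y)) = yk (σ k) := by
        rw [smul_smul, mul_inv_cancel₀ hne, one_smul]
        abel
      change y + t (σ k) • ((t (σ k))⁻¹ • (yk (σ k) - y)) ∈ limitingSubdiff g (Φ xbar +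
        t (σ k) • ((t (σ k))⁻¹ • (Φ (xbar + t (σ k) • (dk (σ k)).snd.snd) - Φ xbar) +
          (dk (σ k)).snd.fst))
      rwa [h1, h2]

/-- If isolated calmness fails under the basic qualification condition, then some direction
`(0, 0, dx)` with `dx ≠ 0` is tangent to the domain of the multiplier mapping. -/
theorem exists_mem_tangentCone_domOf_multMap (hl : LowerSemicontinuous g)
    (hg : IsConvexFun g) (hf₀ : ContDiff ℝ 2 f₀) (hΦ : ContDiff ℝ 2 Φ) {xbar : E}
    (hxbar : xbar ∈ solMap (compositeFun f₀ Φ g) (pair 0 0)) (hcq : BasicCQ Φ g xbar)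
    (hcalm : ¬ IsolatedlyCalmAt (solMap (compositeFun f₀ Φ g)) (pair 0 0) xbar) :
    ∃ dx : E, dx ≠ 0 ∧ pair 0 (pair 0 dx) ∈
      tangentCone (domOf (multMap (compositeFun f₀ Φ g))) (pair 0 (pair 0 xbar)) := by
  obtain ⟨α, hα, -⟩ := hxbar
  have hα' : g (Φ xbar) = ((α - f₀ xbar : ℝ) : EReal) := by
    have := (EReal_coe_add_eq_coe_iff _ _ _).1 hα
    simpa using this
  have hev := hcq.eventually hg hΦ hα'
  simp only [IsolatedlyCalmAt, not_exists, not_and, not_forall, not_le] at hcalm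
  -- the constants `k + 1` and the balls of radius `1 / (k + 1)` make `p k = o(‖x k - xbar‖)`
  choose p x hxmem hlt using fun k : ℕ => hcalm ((k : ℝ) + 1) (by positivity)
    (Metric.ball xbar (1 / ((k : ℝ) + 1))) (Metric.ball_mem_nhds _ (by positivity))
  have h00 : (pair 0 0 : EProd E F) = 0 := rfl
  simp only [h00, sub_zero] at hlt
  let t : ℕ → ℝ := fun k => ‖x k - xbar‖
  have ht0 : ∀ k, 0 < t k := fun k => lt_of_le_of_lt (by positivity) (hlt k)
  have hε := tendsto_one_div_add_atTop_nhds_zero_nat (𝕜 := ℝ)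
  have ht : Tendsto t atTop (𝓝 0) := squeeze_zero (fun k => (ht0 k).le)
    (fun k => by
      have h := (hxmem k).2
      rw [Metric.mem_ball, dist_eq_norm] at h
      exact h.le) hε
  have hx : Tendsto x atTop (𝓝 xbar) := tendsto_iff_norm_sub_tendsto_zero.2 ht
  have hq : Tendsto (fun k => (t k)⁻¹ • p k) atTop (𝓝 0) := squeeze_zero_norm (fun k => by
    have h := hlt k
    rw [norm_smul, norm_inv, Real.norm_of_nonneg (ht0 k).le, inv_mul_le_iff₀ (ht0 k),
      mul_one_div, le_div_iff₀ (by positivity), mul_comm]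
    exact h.le) hε
  have hpq : ∀ k, t k • ((t k)⁻¹ • p k) = p k := fun k => by
    rw [smul_smul, mul_inv_cancel₀ (ht0 k).ne', one_smul]
  have hp0 : Tendsto p atTop (𝓝 0) := by
    have := ht.smul hq
    simpa only [hpq, smul_zero] using this
  have hnorm : ∀ k, ‖(t k)⁻¹ • (x k - xbar)‖ = 1 := fun k =>
    norm_smul_inv_norm (norm_pos_iff.1 (ht0 k))
  obtain ⟨dx, -, σ, hσ, hdx⟩ := tendsto_subseq_of_bounded
    (s := Metric.closedBall (0 : E) 1) Metric.isBounded_closedBall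
    (x := fun k => (t k)⁻¹ • (x k - xbar)) (fun k => by rw [mem_closedBall_zero_iff, hnorm])
  have hdx1 : ‖dx‖ = 1 := by
    refine tendsto_nhds_unique hdx.norm ?_
    simp only [Function.comp_def, hnorm]
    exact tendsto_const_nhds
  have hxu : Tendsto (fun k => (x (σ k), (p (σ k)).snd)) atTop (𝓝 (xbar, 0)) :=
    (hx.prodMk_nhds (tendsto_snd_of_tendsto hp0)).comp hσ.tendsto_atTop
  -- the tangent cone asks for membership at every index, so the sequence is cut at `N`
  obtain ⟨N, hN⟩ := eventually_atTop.1 (hxu.eventually hev)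
  let τ : ℕ → ℕ := fun k => σ (k + N)
  have hτ : Tendsto τ atTop atTop := hσ.tendsto_atTop.comp (tendsto_add_atTop_nat N)
  have hqτ := hq.comp hτ
  refine ⟨dx, fun h => by simp [h] at hdx1, fun k => pair ((t (τ k))⁻¹ • p (τ k)).fst
    (pair ((t (τ k))⁻¹ • p (τ k)).snd ((t (τ k))⁻¹ • (x (τ k) - xbar))), t ∘ τ,
    tendsto_pair (tendsto_fst_of_tendsto hqτ) (tendsto_pair (tendsto_snd_of_tendsto hqτ)
      (hdx.comp (tendsto_add_atTop_nat N))), ⟨fun k => ht0 _, ht.comp hτ⟩, fun k => ?_⟩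
  obtain ⟨y, hy⟩ := exists_mem_multMap_of_mem_solMap (v := (p (τ k)).fst) (u := (p (τ k)).snd)
    hl hg hf₀ hΦ (hN (k + N) (Nat.le_add_left _ _)) (hxmem (τ k)).1
  refine ⟨y, ?_⟩
  rw [pair_zero_add_smul]
  have h1 : t (τ k) • ((t (τ k))⁻¹ • p (τ k)).fst = (p (τ k)).fst :=
    congrArg WithLp.fst (hpq (τ k))
  have h2 : t (τ k) • ((t (τ k))⁻¹ • p (τ k)).snd = (p (τ k)).snd :=
    congrArg WithLp.snd (hpq (τ k))
  have h3 : xbar + t (τ k) • ((t (τ k))⁻¹ • (x (τ k) - xbar)) = x (τ k) := by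
    rw [smul_smul, mul_inv_cancel₀ (ht0 _).ne', one_smul, add_sub_cancel]
  change y ∈ multMap _ (pair (t (τ k) • ((t (τ k))⁻¹ • p (τ k)).fst)
    (pair (t (τ k) • ((t (τ k))⁻¹ • p (τ k)).snd)
      (xbar + t (τ k) • ((t (τ k))⁻¹ • (x (τ k) - xbar)))))
  rw [h1, h2, h3]
  exact hy

end Characterization

end VarAnalysis

end

theorem mainTheorem2 {n m : ℕ}
    (f₀ : EuclideanSpace ℝ (Fin n) → ℝ)
    (F : EuclideanSpace ℝ (Fin n) → EuclideanSpace ℝ (Fin m))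
    (g : EuclideanSpace ℝ (Fin m) → EReal)
    (hf₀ : ContDiff ℝ 2 f₀) (hF : ContDiff ℝ 2 F)
    (hg_proper : VarAnalysis.IsProper g) (hg_lsc : LowerSemicontinuous g)
    (hg_conv : VarAnalysis.IsConvexFun g)
    (xbar : EuclideanSpace ℝ (Fin n))
    (hxbar : xbar ∈ VarAnalysis.solMap (VarAnalysis.compositeFun f₀ F g) (VarAnalysis.pair 0 0)) :
    (VarAnalysis.IsolatedlyCalmAt (VarAnalysis.solMap (VarAnalysis.compositeFun f₀ F g))
        (VarAnalysis.pair 0 0) xbar →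
      (∀ ybar ∈ VarAnalysis.multMap (VarAnalysis.compositeFun f₀ F g)
          (VarAnalysis.pair 0 (VarAnalysis.pair 0 xbar)),
        VarAnalysis.IsNoncritical f₀ F g xbar ybar) ∧
      ∀ dx : EuclideanSpace ℝ (Fin n), dx ≠ 0 →
        VarAnalysis.InnerCalmStarFuzzyAt
          (VarAnalysis.multMap (VarAnalysis.compositeFun f₀ F g))
          (VarAnalysis.pair 0 (VarAnalysis.pair 0 xbar))
          (VarAnalysis.pair 0 (VarAnalysis.pair 0 dx))) ∧
    (VarAnalysis.BasicCQ F g xbar →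
      ((∀ ybar ∈ VarAnalysis.multMap (VarAnalysis.compositeFun f₀ F g)
          (VarAnalysis.pair 0 (VarAnalysis.pair 0 xbar)),
        VarAnalysis.IsNoncritical f₀ F g xbar ybar) ∧
      ∀ dx : EuclideanSpace ℝ (Fin n), dx ≠ 0 →
        VarAnalysis.InnerCalmStarFuzzyAt
          (VarAnalysis.multMap (VarAnalysis.compositeFun f₀ F g))
          (VarAnalysis.pair 0 (VarAnalysis.pair 0 xbar))
          (VarAnalysis.pair 0 (VarAnalysis.pair 0 dx))) →
      VarAnalysis.IsolatedlyCalmAt (VarAnalysis.solMap (VarAnalysis.compositeFun f₀ F g))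
        (VarAnalysis.pair 0 0) xbar) := by
  refine ⟨fun hcalm => ⟨fun ybar hy => hcalm.isNoncritical hg_lsc hg_conv hf₀ hF hy,
    fun dx hdx => Or.inl
      (hcalm.notMem_tangentCone_domOf_multMap hg_lsc hg_conv hf₀ hF hdx)⟩, ?_⟩
  rintro hcq ⟨hnc, hic⟩
  by_contra hcalm
  obtain ⟨dx, hdx, htan⟩ := VarAnalysis.exists_mem_tangentCone_domOf_multMap hg_lsc hg_conv hf₀ hF
    hxbar hcq hcalm
  rcases hic dx hdx with hnot | ⟨κ, hκ, y, dk, t, yk, hd, ht, hy, hk⟩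
  · exact hnot htan
  · exact hdx (VarAnalysis.eq_zero_of_multipliers hg_proper hg_lsc hg_conv hf₀ hF hnc hκ ht hd hy
      (fun k => (hk k).2.1) fun k => (hk k).2.2)
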